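/- Let $M\ge |a|>0$ and consider the Kerr spacetime in Boyer–Lindquist coordinates $(\tau,r,\theta,\phi)$ ($r\in\mathbb R$, $0<\theta<\pi$, $\phi$ taken modulo $2\pi$), with line element $$ds^2=\rho^2\Big(\frac{dr^2}{\Delta}+d\theta^2\Big)+(r^2+a^2)\sin^2\theta\,d\phi^2-d\tau^2+\frac{2Mr}{\rho^2}(a\sin^2\theta\,d\phi-d\tau)^2,$$ where $\rho^2=r^2+a^2\cos^2\theta\neq0$ and $\Delta=r^2-2Mr+a^2\ne0$. A circular closed timelike curve (CTC) of radius $r$ is a $C^2$ closed timelike curve $\gamma$, parametrized by proper time and extended periodically to $\mathbb R$, along which $\tau,r,\theta$ are constant; it is equatorial if $\theta=\pi/2$. $T_\gamma$ is its least period. A spin-vector along $\gamma$ is a unit vector field $s^a$ along $\gamma$, orthogonal to the tangent $u^a$, satisfying the Fermi–Walker equation $u^c\nabla_cs^a=(u^aa_b-a^au_b)s^b$, where $a^a=u^c\nabla_cu^a$. Put $$\Gamma(r)=-\frac{a^2M^2(a^2+3r^2)^2}{r^5(r^3+a^2r+2Ma^2)}.$$ (1) The polynomial $r^3+a^2r+2Ma^2$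 has a unique negative root $r_*$, and there is an equatorial circular CTC of radius $r$ if and only if $r\in(r_*,0)$. (2) Let $\gamma$ be an equatorial circular CTC of radius $r$. Then $T_\gamma=2\pi\sqrt{-g_{\phi\phi}}$, with $g_{\phi\phi}$ evaluated along $\gamma$, and every spin-vector along $\gamma$ is $T_\gamma$-periodic if and only if $\Gamma(r)=n^2$ for some $n\in\mathbb N$. If there is no such $n$, then, up to sign, exactly one spin-vector along $\gamma$ is $T_\gamma$-periodic. (3) $\Gamma(r)\to+\infty$ as $r\to r_*^+$ and as $r\to0^-$. There is $r_m\in(r_*,0)$ with $\Gamma(r_m)>0$ and $\Gamma(r_m)<\Gamma(r)$ for all other $r\in(r_*,0)$, and $\Gamma$ has no local minimum on $(r_*,0)$ other than at $r_m$. (4) For $n\in\mathbb N$, call $r\in(r_*,0)$ consistent at level $n$ if $\Gamma(r)=n^2$ and all spin-vectors along every equatorial circular CTC $\gamma$ of radius $r$ are $T_\gamma$-periodic. If $n^2>\Gamma(r_m)$ there are exactly two radii consistent at level $n$; if $n^2=\Gamma(r_m)$ the only one is $r_m$; if $n^2<\Gamma(r_m)$ there is none. In particular, if $\Gamma(r_m)$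 is not the square of an integer, the "Gödel profile with $n=n_0$" holds for $n_0=\lceil\sqrt{\Gamma(r_m)}\,\rceil$: for each $n\ge n_0$ there are exactly two radii consistent at level $n$, namely the solutions $r\in(r_*,0)$ of $\Gamma(r)=n^2$, and along every equatorial circular CTC of any other radius there is, up to sign, exactly one $T_\gamma$-periodic spin-vector. -/

import Mathlib

open Set Filter Topology

noncomputable section

namespace Lorentz

/-- A metric tensor in a coordinate chart of a four-dimensional spacetime: the matrix
`g x i j = g_{ij}(x)` of its components at the point with coordinates `x`. -/
abbrev MetricField := (Fin 4 → ℝ) → Matrix (Fin 4) (Fin 4) ℝ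

/-- The scalar product `g_{ij} v^i w^j` of two vectors at `x`. -/
def scal (g : MetricField) (x v w : Fin 4 → ℝ) : ℝ :=
  ∑ i, ∑ j, g x i j * v i * w j

/-- The partial derivative `∂f/∂x^j` at `x`. -/
def pderiv (j : Fin 4) (f : (Fin 4 → ℝ) → ℝ) (x : Fin 4 → ℝ) : ℝ :=
  deriv (fun h : ℝ => f (Function.update x j h)) (x j)

/-- Christoffel symbols `Γ^i_{jk}` of the Levi-Civita connection of `g`. -/
def christoffel (g : MetricField) (x : Fin 4 → ℝ) (i j k : Fin 4) : ℝ :=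
  (1 / 2) * ∑ l, (g x)⁻¹ i l *
    (pderiv j (fun y => g y l k) x + pderiv k (fun y => g y l j) x
      - pderiv l (fun y => g y j k) x)

/-- The covariant derivative `u^c ∇_c v^i` along the curve `γ`, with tangent `u = γ'`, of a vector
field `v` along `γ` given by its coordinate components. -/
def covDeriv (g : MetricField) (γ v : ℝ → Fin 4 → ℝ) (t : ℝ) : Fin 4 → ℝ :=
  fun i => deriv v t i + ∑ j, ∑ k, christoffel g (γ t) i j k * deriv γ t j * v t k

/-- The acceleration `a^i = u^c ∇_c u^i` of the curve `γ`. -/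
def accel (g : MetricField) (γ : ℝ → Fin 4 → ℝ) : ℝ → Fin 4 → ℝ :=
  covDeriv g γ (deriv γ)

/-- A spin-vector along a curve `γ` parametrized by proper time: a unit vector field along `γ`,
orthogonal to the tangent `u`, that satisfies the Fermi-Walker transport equation
`u^c ∇_c s^i = (u^i a_b - a^i u_b) s^b`. -/
structure IsSpinVector (g : MetricField) (γ s : ℝ → Fin 4 → ℝ) : Prop where
  diff : Differentiable ℝ s
  transport : ∀ t, covDeriv g γ s t =
    scal g (γ t) (accel g γ t) (s t) • deriv γ t - scal g (γ t) (deriv γ t) (s t) • accel g γ t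
  orth : ∀ t, scal g (γ t) (deriv γ t) (s t) = 0
  unit : ∀ t, scal g (γ t) (s t) (s t) = 1

end Lorentz

namespace Kerr

open Lorentz

/-- `ρ² = r² + a² cos² θ`. -/
def rhoSq (a r θ : ℝ) : ℝ := r ^ 2 + a ^ 2 * Real.cos θ ^ 2

/-- `Δ = r² - 2 M r + a²`. -/
def Delta (M a r : ℝ) : ℝ := r ^ 2 - 2 * M * r + a ^ 2

/-- The component `g_{φφ}` of the Kerr metric. -/
def gPhiPhi (M a r θ : ℝ) : ℝ :=
  (r ^ 2 + a ^ 2) * Real.sin θ ^ 2 + 2 * M * r * a ^ 2 * Real.sin θ ^ 4 / rhoSq a r θ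

/-- The Kerr metric in Boyer-Lindquist coordinates `x = (τ, r, θ, φ)`:
`ρ² (dr²/Δ + dθ²) + (r² + a²) sin² θ dφ² - dτ² + (2 M r / ρ²) (a sin² θ dφ - dτ)²`. -/
def metric (M a : ℝ) : MetricField := fun x =>
  let r := x 1
  let θ := x 2
  !![-1 + 2 * M * r / rhoSq a r θ, 0, 0, -(2 * M * r * a * Real.sin θ ^ 2 / rhoSq a r θ);
     0, rhoSq a r θ / Delta M a r, 0, 0;
     0, 0, rhoSq a r θ, 0;
     -(2 * M * r * a * Real.sin θ ^ 2 / rhoSq a r θ), 0, 0, gPhiPhi M a r θ]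

/-- The range of the Boyer-Lindquist coordinates: off the ring singularity `ρ² = 0`, the horizons
`Δ = 0` and the axis; `r` may be negative. -/
def domain (M a : ℝ) : Set (Fin 4 → ℝ) :=
  {x | rhoSq a (x 1) (x 2) ≠ 0 ∧ Delta M a (x 1) ≠ 0 ∧ 0 < x 2 ∧ x 2 < Real.pi}

/-- Two coordinate quadruples name the same event: `φ` is an angle modulo `2π`. -/
def SameEvent (x y : Fin 4 → ℝ) : Prop :=
  x 0 = y 0 ∧ x 1 = y 1 ∧ x 2 = y 2 ∧ ∃ k : ℤ, x 3 = y 3 + 2 * Real.pi * k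

/-- `γ` is a closed timelike curve of the Kerr spacetime, parametrized by proper time and extended
periodically to all of `ℝ`, with least positive period `T`. The curve is given in Boyer-Lindquist
coordinates, with the angle `φ` lifted continuously to `ℝ`. -/
structure IsCTC (M a : ℝ) (γ : ℝ → Fin 4 → ℝ) (T : ℝ) : Prop where
  smooth : ContDiff ℝ 2 γ
  mem : ∀ t, γ t ∈ domain M a
  timelike : ∀ t, scal (metric M a) (γ t) (deriv γ t) (deriv γ t) = -1
  period : IsLeast {P : ℝ | 0 < P ∧ ∀ t, SameEvent (γ (t + P)) (γ t)} T

/-- `γ` is a circular CTC, with least period `T`, along which `τ`, `r` and `θ` are constant, with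
the given values of `r` and `θ`. -/
structure IsCircularCTC (M a r θ : ℝ) (γ : ℝ → Fin 4 → ℝ) (T : ℝ) : Prop
    extends IsCTC M a γ T where
  tau_const : ∀ t, γ t 0 = γ 0 0
  r_const : ∀ t, γ t 1 = r
  theta_const : ∀ t, γ t 2 = θ

/-- `r` is the radius of some circular CTC in the equatorial plane `θ = π/2`. -/
def IsEquatorialRadius (M a r : ℝ) : Prop :=
  ∃ γ T, IsCircularCTC M a r (Real.pi / 2) γ T

/-- Every spin-vector along `γ` is `T`-periodic. -/
def AllPeriodic (M a : ℝ) (γ : ℝ → Fin 4 → ℝ) (T : ℝ) : Prop :=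
  ∀ s, IsSpinVector (metric M a) γ s → Function.Periodic s T

/-- There is, up to sign, exactly one (unit) spin-vector along `γ` that is `T`-periodic. -/
def UniquePeriodic (M a : ℝ) (γ : ℝ → Fin 4 → ℝ) (T : ℝ) : Prop :=
  ∃ s₀, {s | IsSpinVector (metric M a) γ s ∧ Function.Periodic s T} = {s₀, -s₀}

/-- The polynomial `r³ + a² r + 2 M a²`. -/
def cubic (M a r : ℝ) : ℝ := r ^ 3 + a ^ 2 * r + 2 * M * a ^ 2

/-- `Γ(r) = - a² M² (a² + 3 r²)² / (r⁵ (r³ + a² r + 2 M a²))`. -/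
def Gam (M a r : ℝ) : ℝ :=
  -(a ^ 2 * M ^ 2 * (a ^ 2 + 3 * r ^ 2) ^ 2 / (r ^ 5 * cubic M a r))

/-- The radii `r` of the equatorial circular CTCs such that `Γ(r) = n²` and every spin-vector along
every equatorial circular CTC of radius `r` is periodic with the period of that CTC. -/
def consistentRadii (M a : ℝ) (n : ℕ) : Set ℝ :=
  {r | IsEquatorialRadius M a r ∧ Gam M a r = (n : ℝ) ^ 2 ∧
    ∀ γ T, IsCircularCTC M a r (Real.pi / 2) γ T → AllPeriodic M a γ T}

/-- The Gödel profile with `n = n₀`: for each `n ≥ n₀` there are exactly two equatorial circular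
CTCs (labelled by their radii, the solutions of `Γ(r) = n²`) along which all spin-vectors are
periodic; along all other equatorial circular CTCs there is exactly one periodic spin-vector. -/
def GodelProfile (M a : ℝ) (n₀ : ℕ) : Prop :=
  (∀ n, n₀ ≤ n → (consistentRadii M a n).ncard = 2 ∧
    consistentRadii M a n = {r | IsEquatorialRadius M a r ∧ Gam M a r = (n : ℝ) ^ 2}) ∧
  ∀ r γ T, IsCircularCTC M a r (Real.pi / 2) γ T →
    (∀ n, n₀ ≤ n → r ∉ consistentRadii M a n) → UniquePeriodic M a γ T

end Kerr

end

namespace Kerr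

open Lorentz

/-! ### The function `Γ` -/

/-! An equatorial circular CTC moves in `φ` only, so proper-time parametrization reads `w² g_φφ =
-1` for its angular velocity `w`, where `g_φφ = cubic M a r / r`. This forces `r < 0 < cubic M a r`,
makes `w` constant by continuity, and gives the period `2π/|w|`.

Reflection symmetry removes the `θ`-derivatives of the metric on the equator, so `s^θ` is constant
along a spin-vector. Orthogonality expresses `s^φ` through `s^τ`, and Fermi-Walker transport becomes
a linear system `(s^τ)' = κ s^r`, `(s^r)' = β s^τ` with constant coefficients and `κβ = -w² Γ(r)`
(`isSpinVector_iff`, `spinFreq_sq`). After rescaling, this is a rotation through the angle `2π√Γ(r)`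
per period. All spin-vectors close up exactly when `√Γ(r)` is an integer (`allPeriodic_iff`);
otherwise a nontrivial rotation fixes no nonzero planar vector, and only the two unit normals to the
plane remain (`uniquePeriodic_of_ne_sq`).

The count of radii is calculus: `Γ'` has the sign of `critPoly`, which changes sign once
(`exists_root_critPoly`), so `Γ` falls from `+∞` to its minimum and climbs back to `+∞`
(`exists_Gam_min`, `ncard_level_eq_two`). -/

lemma cubic_strictMono {M a : ℝ} (ha : a ≠ 0) : StrictMono (cubic M a) := by
  intro x y hxy
  -- This product is twice the difference of the two values of the cubic.
  have h : 0 < (y - x) * ((x + y) ^ 2 + x ^ 2 + y ^ 2 + 2 * a ^ 2) := by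
    have := sub_pos.2 hxy
    positivity
  simp only [cubic]
  nlinarith [h]

lemma continuous_cubic (M a : ℝ) : Continuous (cubic M a) := by
  unfold cubic; fun_prop

lemma exists_neg_root_cubic {M a : ℝ} (ha : a ≠ 0) (hM : 0 < M) :
    ∃ rs < 0, cubic M a rs = 0 := by
  have h0 : 0 < cubic M a 0 := by
    simp only [cubic]; positivity
  -- At `-2M` the terms in `a²` cancel and `-8M³` remains.
  have h1 : cubic M a (-2 * M) ≤ 0 := by
    have : 0 < M ^ 3 := by positivity
    simp only [cubic]; nlinarith
  obtain ⟨x, hx, hx0⟩ := intermediate_value_Icc (by linarith : -2 * M ≤ 0)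
    (continuous_cubic M a).continuousOn ⟨h1, h0.le⟩
  refine ⟨x, lt_of_le_of_ne hx.2 ?_, hx0⟩
  rintro rfl
  exact h0.ne' hx0

/-- The polynomial whose sign is that of `Γ'` on `(r_*, 0)`. -/
def critPoly (M a r : ℝ) : ℝ :=
  6 * r ^ 5 + 7 * a ^ 2 * r ^ 3 + 3 * M * a ^ 2 * r ^ 2 + 3 * a ^ 4 * r + 5 * M * a ^ 4

/-- Over the common denominator `r (a² + 3r²) cubic`, the numerator of `Γ'/Γ` is minus the
right-hand side. In this form the sign at a root of the cubic is visible. -/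
lemma critPoly_eq (M a r : ℝ) :
    2 * critPoly M a r = (3 * r ^ 2 + 5 * a ^ 2) * cubic M a r + r * (a ^ 2 + 3 * r ^ 2) ^ 2 := by
  simp only [critPoly, cubic]; ring

/-- The quotient of `critPoly` by the positive factor `3 r² + 5 a²` is strictly increasing. -/
lemma critPoly_div_strictMono {M a : ℝ} (ha : a ≠ 0) :
    StrictMono fun r => critPoly M a r / (3 * r ^ 2 + 5 * a ^ 2) := by
  have hd : ∀ r : ℝ, 0 < 3 * r ^ 2 + 5 * a ^ 2 := fun r => by positivity
  refine strictMono_of_deriv_pos fun r => ?_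
  -- The terms of `critPoly` that contain `M` add up to `M a² (3r² + 5a²)`. Hence `M` contributes
  -- only a constant to the quotient and drops out of the derivative, whose numerator has even
  -- powers and positive coefficients.
  have h : HasDerivAt (fun r => critPoly M a r / (3 * r ^ 2 + 5 * a ^ 2))
      ((54 * r ^ 6 + 171 * a ^ 2 * r ^ 4 + 96 * a ^ 4 * r ^ 2 + 15 * a ^ 6) /
        (3 * r ^ 2 + 5 * a ^ 2) ^ 2) r := by
    have hn : HasDerivAt (critPoly M a)
        (30 * r ^ 4 + 21 * a ^ 2 * r ^ 2 + 6 * M * a ^ 2 * r + 3 * a ^ 4) r := by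
      have := (((((hasDerivAt_pow 5 r).const_mul 6).add
        ((hasDerivAt_pow 3 r).const_mul (7 * a ^ 2))).add
        ((hasDerivAt_pow 2 r).const_mul (3 * M * a ^ 2))).add
        ((hasDerivAt_id r).const_mul (3 * a ^ 4))).add_const (5 * M * a ^ 4)
      exact this.congr_deriv (by norm_num; ring)
    have hq : HasDerivAt (fun r : ℝ => 3 * r ^ 2 + 5 * a ^ 2) (6 * r) r := by
      have := ((hasDerivAt_pow 2 r).const_mul 3).add_const (5 * a ^ 2)
      exact this.congr_deriv (by norm_num; ring)
    refine (hn.div hq (hd r).ne').congr_deriv ?_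
    simp only [critPoly]
    congr 1
    ring
  rw [h.deriv]
  positivity

/-- Opposite signs at `rs` and `0` give a root; strict monotonicity of the quotient by a positive
factor determines the sign on each side of it. -/
lemma exists_root_critPoly {M a rs : ℝ} (ha : a ≠ 0) (hM : 0 < M) (hrs : rs < 0)
    (hc : cubic M a rs = 0) :
    ∃ rm ∈ Ioo rs 0, (∀ r < rm, critPoly M a r < 0) ∧ (∀ r > rm, 0 < critPoly M a r) := by
  have hd : ∀ r : ℝ, 0 < 3 * r ^ 2 + 5 * a ^ 2 := fun r => by positivity
  have h0 : 0 < critPoly M a 0 := by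
    simp only [critPoly]; positivity
  have h1 : critPoly M a rs < 0 := by
    have h := critPoly_eq M a rs
    have : rs * (a ^ 2 + 3 * rs ^ 2) ^ 2 < 0 := mul_neg_of_neg_of_pos hrs (by positivity)
    rw [hc] at h
    linarith
  have hcont : Continuous (critPoly M a) := by unfold critPoly; fun_prop
  obtain ⟨rm, hrm, hrm0⟩ := intermediate_value_Ioo hrs.le hcont.continuousOn ⟨h1, h0⟩
  refine ⟨rm, hrm, fun r hr => ?_, fun r hr => ?_⟩
  · have := critPoly_div_strictMono (M := M) ha hr
    simp only [hrm0, zero_div] at this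
    simpa using (div_lt_iff₀ (hd r)).1 this
  · have := critPoly_div_strictMono (M := M) ha hr
    simp only [hrm0, zero_div] at this
    exact (div_pos_iff_of_pos_right (hd r)).1 this

section

variable {M a rs : ℝ}

lemma cubic_pos_of_mem (ha : a ≠ 0) (hc : cubic M a rs = 0) {r : ℝ} (hr : rs < r) :
    0 < cubic M a r := hc ▸ cubic_strictMono ha hr

lemma Gam_pos (ha : a ≠ 0) (hM : 0 < M) {r : ℝ} (hr : r < 0) (hc : 0 < cubic M a r) :
    0 < Gam M a r := by
  have h5 : r ^ 5 < 0 := Odd.pow_neg (by decide) hr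
  rw [Gam, ← div_neg]
  have : 0 < -(r ^ 5 * cubic M a r) := by nlinarith
  positivity

lemma hasDerivAt_Gam {r : ℝ} (hr : r ≠ 0) (hc : cubic M a r ≠ 0) :
    HasDerivAt (Gam M a)
      (2 * a ^ 2 * M ^ 2 * (a ^ 2 + 3 * r ^ 2) * critPoly M a r / (r ^ 6 * cubic M a r ^ 2)) r := by
  have hcub : HasDerivAt (cubic M a) (3 * r ^ 2 + a ^ 2) r := by
    have := ((hasDerivAt_pow 3 r).add ((hasDerivAt_id r).const_mul (a ^ 2))).add_const
      (2 * M * a ^ 2)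
    exact this.congr_deriv (by norm_num)
  have hn : HasDerivAt (fun r => a ^ 2 * M ^ 2 * (a ^ 2 + 3 * r ^ 2) ^ 2)
      (a ^ 2 * M ^ 2 * (2 * (a ^ 2 + 3 * r ^ 2) * (6 * r))) r := by
    have := ((((hasDerivAt_pow 2 r).const_mul 3).const_add (a ^ 2)).pow 2).const_mul
      (a ^ 2 * M ^ 2)
    exact this.congr_deriv (by push_cast; ring)
  have hd := (hasDerivAt_pow 5 r).mul hcub
  have := (hn.div hd (mul_ne_zero (pow_ne_zero 5 hr) hc)).neg
  refine this.congr_deriv ?_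
  have h2 : critPoly M a r = ((3 * r ^ 2 + 5 * a ^ 2) * cubic M a r
    + r * (a ^ 2 + 3 * r ^ 2) ^ 2) / 2 := by linarith [critPoly_eq M a r]
  rw [h2]
  simp only [Pi.mul_apply]
  generalize cubic M a r = C at *
  field_simp
  norm_num
  ring

lemma tendsto_Gam_root (ha : a ≠ 0) (hM : 0 < M) (hrs : rs < 0) (hc : cubic M a rs = 0) :
    Tendsto (Gam M a) (𝓝[>] rs) atTop := by
  have hd : Tendsto (fun r => -(r ^ 5 * cubic M a r)) (𝓝[>] rs) (𝓝[>] 0) := by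
    refine tendsto_nhdsWithin_iff.2 ⟨?_, ?_⟩
    · have : Continuous fun r => -(r ^ 5 * cubic M a r) := by unfold cubic; fun_prop
      have h := this.tendsto rs
      simp only [hc, mul_zero, neg_zero] at h
      exact h.mono_left nhdsWithin_le_nhds
    · filter_upwards [Ioo_mem_nhdsGT hrs] with r hr
      have := cubic_pos_of_mem ha hc hr.1
      have h5 : r ^ 5 < 0 := Odd.pow_neg (by decide) hr.2
      exact mem_Ioi.2 (by nlinarith)
  have hn : Tendsto (fun r => a ^ 2 * M ^ 2 * (a ^ 2 + 3 * r ^ 2) ^ 2) (𝓝[>] rs)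
      (𝓝 (a ^ 2 * M ^ 2 * (a ^ 2 + 3 * rs ^ 2) ^ 2)) :=
    (Continuous.tendsto (by fun_prop) rs).mono_left nhdsWithin_le_nhds
  refine (hn.pos_mul_atTop (by positivity) (tendsto_inv_nhdsGT_zero.comp hd)).congr fun r => ?_
  simp [Gam, div_eq_mul_inv]

lemma tendsto_Gam_zero (ha : a ≠ 0) (hM : 0 < M) (hrs : rs < 0) (hc : cubic M a rs = 0) :
    Tendsto (Gam M a) (𝓝[<] 0) atTop := by
  have hd : Tendsto (fun r => -(r ^ 5 * cubic M a r)) (𝓝[<] 0) (𝓝[>] 0) := by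
    refine tendsto_nhdsWithin_iff.2 ⟨?_, ?_⟩
    · have : Continuous fun r => -(r ^ 5 * cubic M a r) := by unfold cubic; fun_prop
      have h := this.tendsto 0
      norm_num at h
      exact h.mono_left nhdsWithin_le_nhds
    · filter_upwards [Ioo_mem_nhdsLT hrs] with r hr
      have := cubic_pos_of_mem ha hc hr.1
      have h5 : r ^ 5 < 0 := Odd.pow_neg (by decide) hr.2
      exact mem_Ioi.2 (by nlinarith)
  have hn : Tendsto (fun r => a ^ 2 * M ^ 2 * (a ^ 2 + 3 * r ^ 2) ^ 2) (𝓝[<] 0)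
      (𝓝 (a ^ 2 * M ^ 2 * (a ^ 2 + 3 * 0 ^ 2) ^ 2)) :=
    (Continuous.tendsto (by fun_prop) 0).mono_left nhdsWithin_le_nhds
  refine (hn.pos_mul_atTop (by positivity) (tendsto_inv_nhdsGT_zero.comp hd)).congr fun r => ?_
  simp [Gam, div_eq_mul_inv]

/-- `Γ` decreases strictly on `(r_*, r_m]` and increases strictly on `[r_m, 0)`. -/
lemma exists_Gam_min (ha : a ≠ 0) (hM : 0 < M) (hrs : rs < 0) (hc : cubic M a rs = 0) :
    ∃ rm ∈ Ioo rs 0, StrictAntiOn (Gam M a) (Ioc rs rm) ∧ StrictMonoOn (Gam M a) (Ico rm 0) ∧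
      ∀ r ∈ Ioo rs 0, IsLocalMin (Gam M a) r → r = rm := by
  obtain ⟨rm, hrm, hlt, hgt⟩ := exists_root_critPoly ha hM hrs hc
  have hder : ∀ r ∈ Ioo rs 0, HasDerivAt (Gam M a) _ r := fun r hr =>
    hasDerivAt_Gam hr.2.ne (cubic_pos_of_mem ha hc hr.1).ne'
  have hfac : ∀ r ∈ Ioo rs 0,
      0 < 2 * a ^ 2 * M ^ 2 * (a ^ 2 + 3 * r ^ 2) ∧ 0 < r ^ 6 * cubic M a r ^ 2 := fun r hr => by
    have := cubic_pos_of_mem ha hc hr.1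
    have := hr.2.ne
    constructor <;> positivity
  refine ⟨rm, hrm, ?_, ?_, ?_⟩
  · refine strictAntiOn_of_deriv_neg (convex_Ioc _ _)
      (fun r hr => (hder r ⟨hr.1, hr.2.trans_lt hrm.2⟩).continuousAt.continuousWithinAt)
      fun r hr => ?_
    rw [interior_Ioc] at hr
    have hr' : r ∈ Ioo rs 0 := ⟨hr.1, hr.2.trans hrm.2⟩
    rw [(hder r hr').deriv]
    exact div_neg_of_neg_of_pos (mul_neg_of_pos_of_neg (hfac r hr').1 (hlt r hr.2)) (hfac r hr').2
  · refine strictMonoOn_of_deriv_pos (convex_Ico _ _)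
      (fun r hr => (hder r ⟨hrm.1.trans_le hr.1, hr.2⟩).continuousAt.continuousWithinAt)
      fun r hr => ?_
    rw [interior_Ico] at hr
    have hr' : r ∈ Ioo rs 0 := ⟨hrm.1.trans hr.1, hr.2⟩
    rw [(hder r hr').deriv]
    exact div_pos (mul_pos (hfac r hr').1 (hgt r hr.1)) (hfac r hr').2
  · intro r hr hmin
    have h := hmin.hasDerivAt_eq_zero (hder r hr)
    have hq : critPoly M a r = 0 := by
      by_contra hne
      exact div_ne_zero (mul_ne_zero (hfac r hr).1.ne' hne) (hfac r hr).2.ne' h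
    by_contra hne
    rcases lt_or_gt_of_ne hne with h' | h'
    · exact (hlt r h').ne hq
    · exact (hgt r h').ne' hq

end

/-- A function that decreases strictly and then increases strictly on an open interval, with limit
`+∞` at both ends, takes each value above its minimum exactly twice. -/
lemma ncard_level_eq_two {f : ℝ → ℝ} {p m q c : ℝ} (hm : m ∈ Ioo p q)
    (hf : ContinuousOn f (Ioo p q)) (hanti : StrictAntiOn f (Ioc p m))
    (hmono : StrictMonoOn f (Ico m q)) (hp : Tendsto f (𝓝[>] p) atTop)
    (hq : Tendsto f (𝓝[<] q) atTop) (hc : f m < c) :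
    {x | x ∈ Ioo p q ∧ f x = c}.ncard = 2 := by
  -- The infinite limits supply points on both sides of `m` with values above `c`, so the
  -- intermediate value theorem applies on each side.
  obtain ⟨y, hyc, hy⟩ := ((hp.eventually_gt_atTop c).and (Ioo_mem_nhdsGT hm.1)).exists
  obtain ⟨z, hzc, hz⟩ := ((hq.eventually_gt_atTop c).and (Ioo_mem_nhdsLT hm.2)).exists
  obtain ⟨x₁, hx₁, h₁⟩ := intermediate_value_Ioo' hy.2.le
    (hf.mono fun x hx => ⟨hy.1.trans_le hx.1, hx.2.trans_lt hm.2⟩) ⟨hc, hyc⟩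
  obtain ⟨x₂, hx₂, h₂⟩ := intermediate_value_Ioo hz.1.le
    (hf.mono fun x hx => ⟨hm.1.trans_le hx.1, hx.2.trans_lt hz.2⟩) ⟨hc, hzc⟩
  refine ncard_eq_two.2 ⟨x₁, x₂, (hx₁.2.trans hx₂.1).ne, ?_⟩
  ext x
  simp only [mem_ofPred_eq, mem_insert_iff, mem_singleton_iff]
  constructor
  · rintro ⟨hx, hxc⟩
    rcases le_total x m with h | h
    · exact Or.inl (hanti.injOn ⟨hx.1, h⟩ ⟨hy.1.trans hx₁.1, hx₁.2.le⟩ (hxc.trans h₁.symm))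
    · exact Or.inr (hmono.injOn ⟨h, hx.2⟩ ⟨hx₂.1.le, hx₂.2.trans hz.2⟩ (hxc.trans h₂.symm))
  · rintro (rfl | rfl)
    · exact ⟨⟨hy.1.trans hx₁.1, hx₁.2.trans hm.2⟩, h₁⟩
    · exact ⟨⟨hm.1.trans hx₂.1, hx₂.2.trans hz.2⟩, h₂⟩

end Kerr

namespace Kerr

open Lorentz

/-! ### The Kerr metric and its connection on the equatorial plane -/

section

variable {M a r : ℝ} {x : Fin 4 → ℝ}

lemma metric_equator (hr : r ≠ 0) (h1 : x 1 = r) (h2 : x 2 = Real.pi / 2) :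
    metric M a x = !![-1 + 2 * M / r, 0, 0, -(2 * M * a / r);
      0, r ^ 2 / Delta M a r, 0, 0;
      0, 0, r ^ 2, 0;
      -(2 * M * a / r), 0, 0, cubic M a r / r] := by
  have e : 2 * M * r / r ^ 2 = 2 * M / r := by field_simp
  have e' : 2 * M * r * a / r ^ 2 = 2 * M * a / r := by field_simp
  have e'' : r ^ 2 + a ^ 2 + 2 * M * r * a ^ 2 / r ^ 2 = cubic M a r / r := by
    simp only [cubic]; field_simp
  simp [metric, gPhiPhi, rhoSq, h1, h2, e, e', e'']

lemma scal_equator (hr : r ≠ 0) (h1 : x 1 = r) (h2 : x 2 = Real.pi / 2) (v w : Fin 4 → ℝ) :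
    scal (metric M a) x v w = (-1 + 2 * M / r) * v 0 * w 0
      - 2 * M * a / r * (v 0 * w 3 + v 3 * w 0) + r ^ 2 / Delta M a r * v 1 * w 1
      + r ^ 2 * v 2 * w 2 + cubic M a r / r * v 3 * w 3 := by
  simp [scal, metric_equator hr h1 h2, Fin.sum_univ_four]
  ring

lemma inv_metric_equator (hr : r ≠ 0) (hD : Delta M a r ≠ 0) (h1 : x 1 = r)
    (h2 : x 2 = Real.pi / 2) :
    (metric M a x)⁻¹ = !![-(cubic M a r / (r * Delta M a r)), 0, 0,
        -(2 * M * a / (r * Delta M a r));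
      0, Delta M a r / r ^ 2, 0, 0;
      0, 0, 1 / r ^ 2, 0;
      -(2 * M * a / (r * Delta M a r)), 0, 0, (1 - 2 * M / r) / Delta M a r] := by
  refine Matrix.inv_eq_right_inv ?_
  rw [metric_equator hr h1 h2]
  -- Equivalently, the `(τ, φ)` block of the metric has determinant `-Δ`.
  have hdet : (r - 2 * M) * cubic M a r + 4 * M ^ 2 * a ^ 2 = r ^ 2 * Delta M a r := by
    simp only [cubic, Delta]; ring
  generalize Delta M a r = D at *
  generalize cubic M a r = C at *
  ext i j
  fin_cases i <;> fin_cases j <;>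
    simp [Matrix.mul_apply, Fin.sum_univ_four, hD, hr] <;> field_simp <;>
      first | ring1 | linear_combination hdet

lemma metric_symm (y : Fin 4 → ℝ) (k l : Fin 4) : metric M a y k l = metric M a y l k := by
  fin_cases k <;> fin_cases l <;> simp [metric]

lemma pderiv_metric_tau (k l : Fin 4) : pderiv 0 (fun y => metric M a y k l) x = 0 := by
  simp [pderiv, metric]

lemma pderiv_metric_phi (k l : Fin 4) : pderiv 3 (fun y => metric M a y k l) x = 0 := by
  simp [pderiv, metric]

/-- The metric is symmetric under reflection in the equatorial plane. -/
lemma pderiv_metric_theta (h2 : x 2 = Real.pi / 2) (k l : Fin 4) :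
    pderiv 2 (fun y => metric M a y k l) x = 0 := by
  set f : ℝ → ℝ := fun h => metric M a (Function.update x 2 h) k l with hf
  have hsymm : (fun h => f (Real.pi - h)) = f := by
    ext h
    simp [hf, metric, rhoSq, gPhiPhi, Real.sin_pi_sub, Real.cos_pi_sub]
  -- `π/2` is the fixed point of the reflection, so the derivative there equals its own negative.
  have h := deriv_comp_const_sub f Real.pi (Real.pi / 2)
  rw [hsymm, show Real.pi - Real.pi / 2 = Real.pi / 2 by ring] at h
  change deriv f (x 2) = 0
  rw [h2]
  linarith

/-- The tangent points along `φ`, so only the symbols `Γ^i_{φk}` matter, and these involve no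
derivatives but the radial ones of the `φ` column. -/
lemma pderiv_metric_r (hr : r ≠ 0) (h1 : x 1 = r) (h2 : x 2 = Real.pi / 2) (k : Fin 4) :
    pderiv 1 (fun y => metric M a y k 3) x =
      ![2 * M * a / r ^ 2, 0, 0, 2 * r - 2 * M * a ^ 2 / r ^ 2] k := by
  have hev : ∀ᶠ h in 𝓝 r, h ≠ 0 := isOpen_ne.mem_nhds hr
  simp only [pderiv, h1]
  have hup : ∀ h, Function.update x 1 h 2 = Real.pi / 2 := fun h => by simp [h2]
  have hinv := hasDerivAt_inv hr
  fin_cases k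
  · have hd : HasDerivAt (fun h : ℝ => -(2 * M * a / h)) (2 * M * a / r ^ 2) r := by
      exact (hinv.const_mul (2 * M * a)).neg.congr_deriv (by ring)
    refine (hd.congr_of_eventuallyEq ?_).deriv
    filter_upwards [hev] with h hh
    rw [metric_equator hh (Function.update_self _ _ _) (hup h)]
    simp
  · simp [metric]
  · simp [metric]
  · have hd : HasDerivAt (fun h : ℝ => cubic M a h / h) (2 * r - 2 * M * a ^ 2 / r ^ 2) r := by
      have h0 := ((hasDerivAt_pow 2 r).add_const (a ^ 2)).add (hinv.const_mul (2 * M * a ^ 2))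
      refine (h0.congr_of_eventuallyEq ?_).congr_deriv ?_
      · filter_upwards [hev] with h hh
        simp only [cubic, Pi.add_apply]
        field_simp
      · norm_num; ring
    refine (hd.congr_of_eventuallyEq ?_).deriv
    filter_upwards [hev] with h hh
    rw [metric_equator hh (Function.update_self _ _ _) (hup h)]
    simp

/-- The Christoffel symbols `Γ^i_{φ k}` on the equatorial plane. -/
lemma christoffel_equator (hr : r ≠ 0) (hD : Delta M a r ≠ 0) (h1 : x 1 = r)
    (h2 : x 2 = Real.pi / 2) (i k : Fin 4) :
    christoffel (metric M a) x i 3 k =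
      !![0, -(M * a * (3 * r ^ 2 + a ^ 2) / (r ^ 2 * Delta M a r)), 0, 0;
        -(Delta M a r * (M * a) / r ^ 4), 0, 0, -(Delta M a r / r ^ 2 * (r - M * a ^ 2 / r ^ 2));
        0, 0, 0, 0;
        0, (r - 2 * M - M * a ^ 2 / r ^ 2) / Delta M a r, 0, 0] i k := by
  have hr1 := pderiv_metric_r (M := M) (a := a) hr h1 h2
  simp only [christoffel, inv_metric_equator hr hD h1 h2, Fin.sum_univ_four, pderiv_metric_tau,
    pderiv_metric_phi, pderiv_metric_theta h2, metric_symm (M := M) (a := a) _ 3]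
  fin_cases k <;> fin_cases i <;>
    simp [pderiv_metric_tau, pderiv_metric_phi, pderiv_metric_theta h2, hr1, cubic] <;>
    (try field_simp) <;> (try ring_nf)

end

section

variable {M a r w : ℝ} {γ : ℝ → Fin 4 → ℝ}

lemma covDeriv_equator (hr : r ≠ 0) (hD : Delta M a r ≠ 0) {t : ℝ} (h1 : γ t 1 = r)
    (h2 : γ t 2 = Real.pi / 2) (hγ : deriv γ t = Pi.single 3 w) (v : ℝ → Fin 4 → ℝ) :
    covDeriv (metric M a) γ v t =
      ![deriv v t 0 - M * a * (3 * r ^ 2 + a ^ 2) / (r ^ 2 * Delta M a r) * w * v t 1,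
        deriv v t 1 - Delta M a r * (M * a) / r ^ 4 * w * v t 0
          - Delta M a r / r ^ 2 * (r - M * a ^ 2 / r ^ 2) * w * v t 3,
        deriv v t 2,
        deriv v t 3 + (r - 2 * M - M * a ^ 2 / r ^ 2) / Delta M a r * w * v t 1] := by
  ext i
  have hs : ∑ j, ∑ k, christoffel (metric M a) (γ t) i j k * deriv γ t j * v t k =
      ∑ k, christoffel (metric M a) (γ t) i 3 k * w * v t k := by
    rw [Finset.sum_eq_single 3 (fun j _ hj => by simp [hγ, hj]) (by simp)]
    simp [hγ]
  rw [covDeriv, hs]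
  simp only [christoffel_equator hr hD h1 h2, Fin.sum_univ_four]
  fin_cases i <;> simp <;> ring

/-- The components of the tangent are constant, so only `Γ^r_{φφ} w²` survives. -/
lemma accel_equator (hr : r ≠ 0) (hD : Delta M a r ≠ 0) (h1 : ∀ t, γ t 1 = r)
    (h2 : ∀ t, γ t 2 = Real.pi / 2) (hγ : ∀ t, deriv γ t = Pi.single 3 w) (t : ℝ) :
    accel (metric M a) γ t =
      ![0, -(Delta M a r / r ^ 2 * (r - M * a ^ 2 / r ^ 2) * w ^ 2), 0, 0] := by
  have hc : deriv (deriv γ) t = 0 := by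
    rw [funext hγ]; simp
  rw [accel, covDeriv_equator hr hD (h1 t) (h2 t) (hγ t), hc, hγ t]
  ext i
  fin_cases i <;> simp
  ring

/-- The Fermi-Walker equations along an equatorial circle, in components. -/
lemma isSpinVector_iff (hr : r ≠ 0) (hD : Delta M a r ≠ 0) (hC : cubic M a r ≠ 0)
    (hw : w ^ 2 * cubic M a r = -r) (h1 : ∀ t, γ t 1 = r)
    (h2 : ∀ t, γ t 2 = Real.pi / 2) (hγ : ∀ t, deriv γ t = Pi.single 3 w)
    (s : ℝ → Fin 4 → ℝ) :
    IsSpinVector (metric M a) γ s ↔ Differentiable ℝ s ∧ ∀ t,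
      s t 3 = 2 * M * a / cubic M a r * s t 0 ∧
      deriv s t 0 = w * (M * a * (3 * r ^ 2 + a ^ 2)) / (r ^ 2 * Delta M a r) * s t 1 ∧
      deriv s t 1 =
        w * Delta M a r * (M * a * (3 * r ^ 2 + a ^ 2)) / (r ^ 3 * cubic M a r) * s t 0 ∧
      deriv s t 2 = 0 ∧
      -(Delta M a r * r / cubic M a r) * s t 0 ^ 2 + r ^ 2 / Delta M a r * s t 1 ^ 2
        + r ^ 2 * s t 2 ^ 2 = 1 := by
  have hw0 : w ≠ 0 := by
    rintro rfl
    exact hr (by linarith)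
  have horth : ∀ t, scal (metric M a) (γ t) (deriv γ t) (s t) = 0 ↔
      s t 3 = 2 * M * a / cubic M a r * s t 0 := fun t => by
    rw [scal_equator hr (h1 t) (h2 t), hγ]
    simp
    constructor
    · intro h
      field_simp at h ⊢
      have h := (mul_eq_zero.1 (h.trans (mul_zero r))).resolve_left hw0
      linear_combination h
    · intro h
      rw [h]
      field_simp
      ring
  have hunit : ∀ t, s t 3 = 2 * M * a / cubic M a r * s t 0 →
      scal (metric M a) (γ t) (s t) (s t) = -(Delta M a r * r / cubic M a r) * s t 0 ^ 2
        + r ^ 2 / Delta M a r * s t 1 ^ 2 + r ^ 2 * s t 2 ^ 2 := fun t h => by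
    rw [scal_equator hr (h1 t) (h2 t), h]
    have hdet : (r - 2 * M) * cubic M a r + 4 * M ^ 2 * a ^ 2 = r ^ 2 * Delta M a r := by
      simp only [cubic, Delta]; ring
    generalize Delta M a r = D at *
    generalize cubic M a r = C at *
    field_simp
    linear_combination (-D * s t 0 ^ 2) * hdet
  -- Differentiating the orthogonality relation ties the `φ` equation to the `τ` equation.
  have hs3 : Differentiable ℝ s → (∀ t, s t 3 = 2 * M * a / cubic M a r * s t 0) →
      ∀ t, deriv s t 3 = 2 * M * a / cubic M a r * deriv s t 0 := fun hd h t => by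
    have hi : ∀ i, HasDerivAt (fun t => s t i) (deriv s t i) t :=
      hasDerivAt_pi.1 (hd t).hasDerivAt
    exact (hi 3).unique (((hi 0).const_mul _).congr_of_eventuallyEq (.of_forall h))
  have hC3 : cubic M a r + 2 * r ^ 3 - 2 * M * a ^ 2 = r * (3 * r ^ 2 + a ^ 2) := by
    simp only [cubic]; ring
  -- With `s^φ` eliminated, the two connection terms of the radial equation merge into one multiple
  -- of `s^τ`.
  have hβ : ∀ y : ℝ, Delta M a r * (M * a) / r ^ 4 * w * y
      + Delta M a r / r ^ 2 * (r - M * a ^ 2 / r ^ 2) * w * (2 * M * a / cubic M a r * y) =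
      w * Delta M a r * (M * a * (3 * r ^ 2 + a ^ 2)) / (r ^ 3 * cubic M a r) * y := fun y => by
    generalize cubic M a r = C at *
    field_simp
    linear_combination M * a * y * hC3
  have htrans : (∀ t, s t 3 = 2 * M * a / cubic M a r * s t 0) →
      (∀ t, deriv s t 3 = 2 * M * a / cubic M a r * deriv s t 0) → ∀ t,
      (covDeriv (metric M a) γ s t = scal (metric M a) (γ t) (accel (metric M a) γ t) (s t) •
        deriv γ t - scal (metric M a) (γ t) (deriv γ t) (s t) • accel (metric M a) γ t ↔
      deriv s t 0 = w * (M * a * (3 * r ^ 2 + a ^ 2)) / (r ^ 2 * Delta M a r) * s t 1 ∧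
      deriv s t 1 =
        w * Delta M a r * (M * a * (3 * r ^ 2 + a ^ 2)) / (r ^ 3 * cubic M a r) * s t 0 ∧
      deriv s t 2 = 0) := fun h h' t => by
    rw [(horth t).2 (h t), covDeriv_equator hr hD (h1 t) (h2 t) (hγ t),
      accel_equator hr hD h1 h2 hγ, scal_equator hr (h1 t) (h2 t), hγ, h' t, h t, ← hβ (s t 0)]
    simp [funext_iff, Fin.forall_fin_succ]
    have hw2 : w ^ 2 = -r / cubic M a r := by rw [← hw]; field_simp
    -- This identity makes the `φ` component of the transport equation a consequence of the `τ`
    -- component.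
    have h4 : 2 * M ^ 2 * a ^ 2 * (3 * r ^ 2 + a ^ 2)
        + (r ^ 3 - 2 * M * r ^ 2 - M * a ^ 2) * cubic M a r =
        r * (r ^ 3 - M * a ^ 2) * Delta M a r := by
      simp only [cubic, Delta]; ring
    constructor
    · rintro ⟨e0, e1, e2, -⟩
      exact ⟨by linear_combination e0, by linear_combination e1, e2⟩
    · rintro ⟨e0, e1, e2⟩
      refine ⟨by linear_combination e0, by linear_combination e1, e2, ?_⟩
      rw [e0, hw2]
      generalize Delta M a r = D at *
      generalize cubic M a r = C at *
      field_simp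
      linear_combination s t 1 * h4
  constructor
  · rintro ⟨hd, ht, ho, hu⟩
    have ho' := fun t => (horth t).1 (ho t)
    refine ⟨hd, fun t => ?_⟩
    obtain ⟨e0, e1, e2⟩ := (htrans ho' (hs3 hd ho') t).1 (ht t)
    exact ⟨ho' t, e0, e1, e2, hunit t (ho' t) ▸ hu t⟩
  · rintro ⟨hd, h⟩
    have ho' := fun t => (h t).1
    refine ⟨hd, fun t => ?_, fun t => (horth t).2 (ho' t), fun t => ?_⟩
    · exact (htrans ho' (hs3 hd ho') t).2 ⟨(h t).2.1, (h t).2.2.1, (h t).2.2.2.1⟩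
    · rw [hunit t (ho' t)]; exact (h t).2.2.2.2

end

end Kerr

namespace Kerr

open Lorentz

/-! ### Equatorial circular closed timelike curves -/

lemma Delta_pos_of_neg {M a r : ℝ} (hM : 0 < M) (hr : r < 0) : 0 < Delta M a r := by
  simp only [Delta]
  nlinarith [sq_nonneg a, sq_pos_of_neg hr, mul_pos hM (neg_pos.2 hr)]

lemma gPhiPhi_equator {M a r : ℝ} (hr : r ≠ 0) :
    gPhiPhi M a r (Real.pi / 2) = cubic M a r / r := by
  simp only [gPhiPhi, rhoSq, cubic, Real.sin_pi_div_two, Real.cos_pi_div_two]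
  field_simp
  ring

section

variable {M a r T : ℝ} {γ : ℝ → Fin 4 → ℝ}

lemma IsCircularCTC.hasDerivAt (h : IsCircularCTC M a r (Real.pi / 2) γ T) (t : ℝ) (i : Fin 4) :
    HasDerivAt (fun t => γ t i) (deriv γ t i) t :=
  hasDerivAt_pi.1 ((h.smooth.differentiable (by norm_num)) t).hasDerivAt i

lemma IsCircularCTC.radius_ne_zero (h : IsCircularCTC M a r (Real.pi / 2) γ T) : r ≠ 0 := by
  have := (h.mem 0).1
  rw [h.r_const, h.theta_const] at this
  simpa [rhoSq] using this

lemma IsCircularCTC.deriv_eq (h : IsCircularCTC M a r (Real.pi / 2) γ T) (t : ℝ) :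
    deriv γ t = Pi.single 3 (deriv γ t 3) := by
  have hz : ∀ (i : Fin 4) (c : ℝ), (∀ t, γ t i = c) → deriv γ t i = 0 := fun i c hc =>
    (h.hasDerivAt t i).unique ((hasDerivAt_const t c).congr_of_eventuallyEq (.of_forall hc))
  ext i
  fin_cases i
  · simpa using hz 0 _ h.tau_const
  · simpa using hz 1 _ h.r_const
  · simpa using hz 2 _ h.theta_const
  · simp

lemma IsCircularCTC.sq_deriv (h : IsCircularCTC M a r (Real.pi / 2) γ T) (t : ℝ) :
    (deriv γ t 3) ^ 2 * cubic M a r = -r := by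
  have hr := h.radius_ne_zero
  have ht := h.timelike t
  rw [scal_equator hr (h.r_const t) (h.theta_const t), h.deriv_eq t] at ht
  simp at ht
  field_simp at ht
  linarith

/-- Signs in `w² cubic = -r` decide: for `r > 0` the cubic would be positive, a contradiction, and
for `r < 0` the left side must be positive. -/
lemma IsCircularCTC.radius_neg_and_cubic_pos (h : IsCircularCTC M a r (Real.pi / 2) γ T)
    (hM : 0 < M) : r < 0 ∧ 0 < cubic M a r := by
  have hr := h.radius_ne_zero
  have hsq := h.sq_deriv 0
  have h2 := sq_nonneg (deriv γ 0 3)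
  have hneg : r < 0 := by
    by_contra hn
    have hpos : 0 < r := lt_of_le_of_ne (not_lt.1 hn) hr.symm
    have : 0 ≤ cubic M a r := by simp only [cubic]; positivity
    nlinarith
  refine ⟨hneg, ?_⟩
  by_contra hn
  nlinarith

/-- The angular velocity of an equatorial circular CTC is constant. -/
lemma IsCircularCTC.exists_velocity (h : IsCircularCTC M a r (Real.pi / 2) γ T) (hM : 0 < M) :
    ∃ w : ℝ, w ^ 2 * cubic M a r = -r ∧ ∀ t, deriv γ t = Pi.single 3 w := by
  obtain ⟨hr, hC⟩ := h.radius_neg_and_cubic_pos hM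
  have hcont : Continuous fun t => deriv γ t 3 :=
    (continuous_apply 3).comp (h.smooth.continuous_deriv (by norm_num))
  have hne : ∀ t, deriv γ t 3 ≠ 0 := fun t h0 => by
    have := h.sq_deriv t
    rw [h0] at this
    linarith
  have hsq : ∀ t, deriv γ t 3 ^ 2 = deriv γ 0 3 ^ 2 := fun t =>
    mul_right_cancel₀ hC.ne' ((h.sq_deriv t).trans (h.sq_deriv 0).symm)
  -- A continuous function on the line with constant nonzero square cannot switch sign.
  have heq := isPreconnected_univ.eq_of_sq_eq (f := fun t => deriv γ t 3)
    (g := fun _ => deriv γ 0 3) hcont.continuousOn continuousOn_const (fun t _ => hsq t)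
    (fun _ => hne 0) (mem_univ 0) rfl
  refine ⟨deriv γ 0 3, h.sq_deriv 0, fun t => ?_⟩
  rw [h.deriv_eq t]
  exact congrArg _ (heq (mem_univ t))

/-- The least period of a curve that winds around the axis with constant angular velocity. -/
lemma isLeast_period {w : ℝ} (hw : w ≠ 0) (h0 : ∀ t, γ t 0 = γ 0 0) (h1 : ∀ t, γ t 1 = γ 0 1)
    (h2 : ∀ t, γ t 2 = γ 0 2) (h3 : ∀ t, γ t 3 = γ 0 3 + w * t) :
    IsLeast {P : ℝ | 0 < P ∧ ∀ t, SameEvent (γ (t + P)) (γ t)} (2 * Real.pi / |w|) := by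
  have hw' := abs_pos.2 hw
  constructor
  · refine ⟨by positivity, fun t => ⟨by rw [h0, h0 t], by rw [h1, h1 t], by rw [h2, h2 t], ?_⟩⟩
    rcases abs_choice w with hs | hs
    · refine ⟨1, ?_⟩
      rw [h3, h3 t, hs]
      field_simp
      push_cast
      ring
    · refine ⟨-1, ?_⟩
      rw [h3, h3 t, hs]
      field_simp
      push_cast
      ring
  · rintro P ⟨hP, hk⟩
    obtain ⟨-, -, -, k, hk⟩ := hk 0
    rw [h3, h3 0] at hk
    have hk' : w * P = 2 * Real.pi * k := by linarith
    have hk0 : k ≠ 0 := by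
      rintro rfl
      simp [hw, hP.ne'] at hk'
    have h1k : (1 : ℝ) ≤ |(k : ℝ)| := by exact_mod_cast Int.one_le_abs hk0
    rw [div_le_iff₀ hw']
    have habs : P * |w| = 2 * Real.pi * |(k : ℝ)| := by
      have := congrArg abs hk'
      rw [abs_mul, abs_mul, abs_of_pos hP, abs_of_pos Real.two_pi_pos] at this
      linarith
    rw [habs]
    exact le_mul_of_one_le_right Real.two_pi_pos.le h1k

lemma eq_add_mul_of_deriv {f : ℝ → ℝ} {w : ℝ} (h : ∀ t, HasDerivAt f w t) (t : ℝ) :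
    f t = f 0 + w * t := by
  have hd : ∀ t, HasDerivAt (fun t => f t - w * t) 0 t := fun t =>
    ((h t).sub ((hasDerivAt_id t).const_mul w)).congr_deriv (by ring)
  have := is_const_of_deriv_eq_zero (fun t => (hd t).differentiableAt) (fun t => (hd t).deriv) t 0
  simp only [mul_zero] at this
  linarith

lemma IsCircularCTC.period_eq (h : IsCircularCTC M a r (Real.pi / 2) γ T) {w : ℝ} (hw : w ≠ 0)
    (hγ : ∀ t, deriv γ t = Pi.single 3 w) : T = 2 * Real.pi / |w| := by
  refine h.period.unique (isLeast_period hw h.tau_const (fun t => ?_) (fun t => ?_)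
    (eq_add_mul_of_deriv fun t => ?_))
  · rw [h.r_const, h.r_const 0]
  · rw [h.theta_const, h.theta_const 0]
  · simpa [hγ t] using h.hasDerivAt t 3

lemma two_pi_mul_sqrt_gPhiPhi {w : ℝ} (hr : r < 0) (hw : w ^ 2 * cubic M a r = -r) :
    2 * Real.pi * √(-gPhiPhi M a r (Real.pi / 2)) = 2 * Real.pi / |w| := by
  have hw0 : w ≠ 0 := by
    rintro rfl
    linarith
  have : -gPhiPhi M a r (Real.pi / 2) = (|w|⁻¹) ^ 2 := by
    have hr' := hr.ne
    rw [gPhiPhi_equator hr', inv_pow, sq_abs, eq_comm, inv_eq_iff_eq_inv,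
      eq_comm, inv_eq_iff_eq_inv, eq_comm]
    field_simp
    linarith
  rw [this, Real.sqrt_sq (by positivity), div_eq_mul_inv]

lemma isEquatorialRadius_of_neg (hM : 0 < M) (hr : r < 0) (hC : 0 < cubic M a r) :
    IsEquatorialRadius M a r := by
  -- The angular velocity that normalizes the tangent of `φ = w t`.
  set w : ℝ := √(-r / cubic M a r) with hw
  have hw2 : w ^ 2 * cubic M a r = -r := by
    rw [hw, Real.sq_sqrt (div_nonneg (by linarith) hC.le)]
    field_simp
  have hw0 : w ≠ 0 := by
    intro h0
    rw [h0] at hw2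
    linarith
  set γ : ℝ → Fin 4 → ℝ := fun t => ![0, r, Real.pi / 2, w * t] with hγ
  have hder : ∀ t, deriv γ t = Pi.single 3 w := fun t => by
    refine (hasDerivAt_pi.2 fun i => ?_).deriv
    fin_cases i
    · simpa [hγ] using hasDerivAt_const t (0 : ℝ)
    · simpa [hγ] using hasDerivAt_const t r
    · simpa [hγ] using hasDerivAt_const t (Real.pi / 2)
    · simpa [hγ] using (hasDerivAt_id t).const_mul w
  refine ⟨γ, 2 * Real.pi / |w|, ⟨⟨?_, fun t => ⟨?_, ?_, ?_, ?_⟩, fun t => ?_,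
    isLeast_period hw0 ?_ ?_ ?_ ?_⟩, ?_, ?_, ?_⟩⟩
  · refine contDiff_pi.2 fun i => ?_
    fin_cases i <;> simp [hγ] <;> fun_prop
  · simp [hγ, rhoSq, hr.ne]
  · simpa [hγ] using (Delta_pos_of_neg hM hr).ne'
  · simp [hγ, Real.pi_pos]
  · simp [hγ, Real.pi_pos]
  · rw [scal_equator hr.ne (by simp [hγ]) (by simp [hγ]), hder]
    have hr' := hr.ne
    simp
    field_simp
    linarith
  all_goals simp [hγ]

end

/-! ### Spin-vectors along an equatorial circle -/

/-- Solutions of the rotation equations `p' = ω q`, `q' = -ω p`. -/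
lemma rotation_solution {p q : ℝ → ℝ} {ω : ℝ} (hp : ∀ t, HasDerivAt p (ω * q t) t)
    (hq : ∀ t, HasDerivAt q (-(ω * p t)) t) (t : ℝ) :
    p t = p 0 * Real.cos (ω * t) + q 0 * Real.sin (ω * t) ∧
      q t = q 0 * Real.cos (ω * t) - p 0 * Real.sin (ω * t) := by
  have hl : ∀ t, HasDerivAt (fun t => ω * t) ω t := fun t => by
    simpa using (hasDerivAt_id t).const_mul ω
  -- Rotating `(p, q)` back through the angle `ωt` gives a constant vector.
  have hA : ∀ t, HasDerivAt (fun t => p t * Real.cos (ω * t) - q t * Real.sin (ω * t)) 0 t :=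
    fun t => (((hp t).mul (hl t).cos).sub ((hq t).mul (hl t).sin)).congr_deriv (by ring)
  have hB : ∀ t, HasDerivAt (fun t => p t * Real.sin (ω * t) + q t * Real.cos (ω * t)) 0 t :=
    fun t => (((hp t).mul (hl t).sin).add ((hq t).mul (hl t).cos)).congr_deriv (by ring)
  have eA := is_const_of_deriv_eq_zero (fun t => (hA t).differentiableAt)
    (fun t => (hA t).deriv) t 0
  have eB := is_const_of_deriv_eq_zero (fun t => (hB t).differentiableAt)
    (fun t => (hB t).deriv) t 0
  simp only [mul_zero, Real.cos_zero, Real.sin_zero, mul_one, sub_zero, zero_add] at eA eB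
  have hcs := Real.sin_sq_add_cos_sq (ω * t)
  constructor
  · linear_combination Real.cos (ω * t) * eA + Real.sin (ω * t) * eB - p t * hcs
  · linear_combination Real.cos (ω * t) * eB - Real.sin (ω * t) * eA - q t * hcs

/-- The angular frequency, in proper time, of the precession of a spin-vector. -/
noncomputable def spinFreq (M a r w : ℝ) : ℝ := |w| * √(Gam M a r)

/-- The coupling constant of the spin components `s^τ` and `s^r`. -/
noncomputable def spinCoupling (M a r w : ℝ) : ℝ := w * (M * a * (3 * r ^ 2 + a ^ 2)) / (r ^ 2 * Delta M a r)

section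

variable {M a r w : ℝ} {γ : ℝ → Fin 4 → ℝ}

lemma spinCoupling_ne_zero (ha : a ≠ 0) (hM : 0 < M) (hr : r < 0) (hw : w ≠ 0) :
    spinCoupling M a r w ≠ 0 := by
  have := Delta_pos_of_neg (a := a) hM hr
  have := hr.ne
  rw [spinCoupling]
  have : 3 * r ^ 2 + a ^ 2 ≠ 0 := by positivity
  positivity

lemma spinFreq_pos (ha : a ≠ 0) (hM : 0 < M) (hr : r < 0) (hC : 0 < cubic M a r) (hw : w ≠ 0) :
    0 < spinFreq M a r w := by
  have := Gam_pos ha hM hr hC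
  rw [spinFreq]
  positivity

/-- The right side is minus the product of the coefficients in the equations for `s^τ` and `s^r`;
this is where `Γ` enters the dynamics. -/
lemma spinFreq_sq (ha : a ≠ 0) (hM : 0 < M) (hr : r < 0) (hC : 0 < cubic M a r) :
    spinFreq M a r w ^ 2 = -(spinCoupling M a r w *
      (w * Delta M a r * (M * a * (3 * r ^ 2 + a ^ 2)) / (r ^ 3 * cubic M a r))) := by
  have hD := Delta_pos_of_neg (a := a) hM hr
  have hr' := hr.ne
  rw [spinFreq, mul_pow, sq_abs, Real.sq_sqrt (Gam_pos ha hM hr hC).le, Gam, spinCoupling]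
  field_simp
  ring

/-- Scaling `s^τ` by the frequency and `s^r` by the coupling turns the system into the equations of
`rotation_solution`. -/
lemma spinVector_solution (ha : a ≠ 0) (hM : 0 < M) (hr : r < 0) (hC : 0 < cubic M a r)
    (hw : w ^ 2 * cubic M a r = -r) (h1 : ∀ t, γ t 1 = r)
    (h2 : ∀ t, γ t 2 = Real.pi / 2) (hγ : ∀ t, deriv γ t = Pi.single 3 w)
    {s : ℝ → Fin 4 → ℝ} (hs : IsSpinVector (metric M a) γ s) (t : ℝ) :
    spinFreq M a r w * s t 0 = spinFreq M a r w * s 0 0 * Real.cos (spinFreq M a r w * t)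
        + spinCoupling M a r w * s 0 1 * Real.sin (spinFreq M a r w * t) ∧
      spinCoupling M a r w * s t 1 = spinCoupling M a r w * s 0 1 *
        Real.cos (spinFreq M a r w * t)
        - spinFreq M a r w * s 0 0 * Real.sin (spinFreq M a r w * t) ∧
      s t 2 = s 0 2 ∧ s t 3 = 2 * M * a / cubic M a r * s t 0 := by
  obtain ⟨hd, h⟩ := (isSpinVector_iff hr.ne (Delta_pos_of_neg hM hr).ne' hC.ne' hw h1 h2 hγ s).1 hs
  have hi : ∀ t i, HasDerivAt (fun t => s t i) (deriv s t i) t := fun t =>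
    hasDerivAt_pi.1 (hd t).hasDerivAt
  have hω := spinFreq_sq (w := w) ha hM hr hC
  obtain ⟨e0, e1⟩ := rotation_solution (ω := spinFreq M a r w)
    (p := fun t => spinFreq M a r w * s t 0) (q := fun t => spinCoupling M a r w * s t 1)
    (fun t => ((hi t 0).const_mul _).congr_deriv (by rw [(h t).2.1, ← spinCoupling]))
    (fun t => ((hi t 1).const_mul _).congr_deriv (by
      rw [(h t).2.2.1]; linear_combination s t 0 * hω)) t
  refine ⟨e0, e1, ?_, (h t).1⟩
  exact is_const_of_deriv_eq_zero (fun t => (hi t 2).differentiableAt)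
    (fun t => (hi t 2).deriv.trans (h t).2.2.2.1) t 0

/-- A spin-vector that precesses in the equatorial plane. -/
lemma exists_planar_spinVector (ha : a ≠ 0) (hM : 0 < M) (hr : r < 0) (hC : 0 < cubic M a r)
    (hw : w ^ 2 * cubic M a r = -r) (h1 : ∀ t, γ t 1 = r)
    (h2 : ∀ t, γ t 2 = Real.pi / 2) (hγ : ∀ t, deriv γ t = Pi.single 3 w) :
    ∃ s, IsSpinVector (metric M a) γ s ∧ s 0 0 = 0 ∧ s 0 1 ≠ 0 := by
  have hD := Delta_pos_of_neg (a := a) hM hr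
  have hw0 : w ≠ 0 := by
    rintro rfl
    linarith
  have hω2 := spinFreq_sq (w := w) ha hM hr hC
  have hω := spinFreq_pos ha hM hr hC hw0
  have hr' := hr.ne
  -- `c` is the length factor for which `c ∂_r`, the value at `t = 0`, is a unit vector.
  obtain ⟨c, hc0, hc⟩ : ∃ c : ℝ, c ≠ 0 ∧ c ^ 2 = Delta M a r / r ^ 2 :=
    ⟨√(Delta M a r / r ^ 2), by positivity, Real.sq_sqrt (by positivity)⟩
  -- This relation gives the `sin²` and `cos²` terms of the norm equal coefficients, so the norm
  -- stays 1.
  have hκ : spinCoupling M a r w ^ 2 * Delta M a r ^ 2 =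
      -(r * cubic M a r) * spinFreq M a r w ^ 2 := by
    rw [hω2, spinCoupling]
    field_simp
  have hl : ∀ t, HasDerivAt (fun t => spinFreq M a r w * t) (spinFreq M a r w) t := fun t => by
    simpa using (hasDerivAt_id t).const_mul (spinFreq M a r w)
  set s : ℝ → Fin 4 → ℝ := fun t =>
    ![spinCoupling M a r w / spinFreq M a r w * c * Real.sin (spinFreq M a r w * t),
      c * Real.cos (spinFreq M a r w * t), 0, 2 * M * a / cubic M a r *
        (spinCoupling M a r w / spinFreq M a r w * c * Real.sin (spinFreq M a r w * t))] with hs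
  have hd : ∀ t, HasDerivAt s
      ![spinCoupling M a r w * c * Real.cos (spinFreq M a r w * t),
        -(c * spinFreq M a r w * Real.sin (spinFreq M a r w * t)), 0, 2 * M * a / cubic M a r *
        (spinCoupling M a r w * c * Real.cos (spinFreq M a r w * t))] t := fun t => by
    have h0 : HasDerivAt (fun t => spinCoupling M a r w / spinFreq M a r w * c *
        Real.sin (spinFreq M a r w * t))
        (spinCoupling M a r w * c * Real.cos (spinFreq M a r w * t)) t :=
      ((hl t).sin.const_mul _).congr_deriv (by field_simp)
    refine hasDerivAt_pi.2 fun i => ?_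
    fin_cases i
    · exact h0
    · exact ((hl t).cos.const_mul c).congr_deriv (by simp; ring)
    · exact hasDerivAt_const t 0
    · exact h0.const_mul _
  refine ⟨s, (isSpinVector_iff hr' hD.ne' hC.ne' hw h1 h2 hγ s).2
    ⟨fun t => (hd t).differentiableAt, fun t => ?_⟩, by simp [hs], by simpa [hs] using hc0⟩
  rw [(hd t).deriv]
  refine ⟨by simp [hs], ?_, ?_, rfl, ?_⟩
  · rw [← spinCoupling]
    simp [hs]
    ring
  · generalize w * Delta M a r * (M * a * (3 * r ^ 2 + a ^ 2)) / (r ^ 3 * cubic M a r) = β at *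
    simp [hs]
    field_simp
    linear_combination (-Real.sin (spinFreq M a r w * t)) * hω2
  · have hcs := Real.sin_sq_add_cos_sq (spinFreq M a r w * t)
    simp only [hs, Matrix.cons_val_zero, Matrix.cons_val_one, Matrix.cons_val]
    simp only [mul_pow, hc, div_pow]
    generalize spinFreq M a r w = ω at *
    generalize cubic M a r = C at *
    field_simp
    linear_combination (r * C * ω ^ 2) * hcs - Real.sin (ω * t) ^ 2 * hκ

/-- The spin-vector normal to the equatorial plane. -/
lemma isSpinVector_normal (hM : 0 < M) (hr : r < 0) (hC : 0 < cubic M a r)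
    (hw : w ^ 2 * cubic M a r = -r) (h1 : ∀ t, γ t 1 = r)
    (h2 : ∀ t, γ t 2 = Real.pi / 2) (hγ : ∀ t, deriv γ t = Pi.single 3 w) {z : ℝ}
    (hz : r ^ 2 * z ^ 2 = 1) :
    IsSpinVector (metric M a) γ (fun _ => ![0, 0, z, 0]) := by
  refine (isSpinVector_iff hr.ne (Delta_pos_of_neg hM hr).ne' hC.ne' hw h1 h2 hγ _).2
    ⟨differentiable_const _, fun t => ?_⟩
  simp [hz]

/-- In one period the planar part turns through `2π√Γ`. A single planar spin-vector that returns
already forces `√Γ` to be an integer. -/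
lemma allPeriodic_iff (ha : a ≠ 0) (hM : 0 < M) (hr : r < 0) (hC : 0 < cubic M a r)
    (hw : w ^ 2 * cubic M a r = -r) (h1 : ∀ t, γ t 1 = r)
    (h2 : ∀ t, γ t 2 = Real.pi / 2) (hγ : ∀ t, deriv γ t = Pi.single 3 w) :
    AllPeriodic M a γ (2 * Real.pi / |w|) ↔ ∃ n : ℕ, Gam M a r = (n : ℝ) ^ 2 := by
  have hw0 : w ≠ 0 := by
    rintro rfl
    linarith
  have hω := spinFreq_pos ha hM hr hC hw0
  have hκ := spinCoupling_ne_zero ha hM hr hw0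
  have hG := Gam_pos ha hM hr hC
  have hωT : spinFreq M a r w * (2 * Real.pi / |w|) = √(Gam M a r) * (2 * Real.pi) := by
    rw [spinFreq]
    field_simp
  constructor
  · intro h
    obtain ⟨s, hs, h00, h01⟩ := exists_planar_spinVector ha hM hr hC hw h1 h2 hγ
    have hp := h s hs 0
    rw [zero_add] at hp
    have h' := (spinVector_solution ha hM hr hC hw h1 h2 hγ hs (2 * Real.pi / |w|)).2.1
    rw [hp, h00, hωT] at h'
    have hcos : Real.cos (√(Gam M a r) * (2 * Real.pi)) = 1 := by
      refine mul_left_cancel₀ (mul_ne_zero hκ h01) ?_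
      linear_combination -h'
    obtain ⟨k, hk⟩ := (Real.cos_eq_one_iff _).1 hcos
    have hk' : (k : ℝ) = √(Gam M a r) := mul_right_cancel₀ Real.two_pi_pos.ne' hk
    refine ⟨k.natAbs, ?_⟩
    rw [Nat.cast_natAbs, Int.cast_abs, sq_abs, hk', Real.sq_sqrt hG.le]
  · rintro ⟨n, hn⟩ s hs t
    have hsq : √(Gam M a r) = n := by rw [hn, Real.sqrt_sq n.cast_nonneg]
    have hcos : Real.cos (spinFreq M a r w * (t + 2 * Real.pi / |w|)) =
        Real.cos (spinFreq M a r w * t) := by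
      rw [mul_add, hωT, hsq, Real.cos_add_nat_mul_two_pi]
    have hsin : Real.sin (spinFreq M a r w * (t + 2 * Real.pi / |w|)) =
        Real.sin (spinFreq M a r w * t) := by
      rw [mul_add, hωT, hsq, Real.sin_add_nat_mul_two_pi]
    obtain ⟨a0, a1, a2, a3⟩ := spinVector_solution ha hM hr hC hw h1 h2 hγ hs (t + 2 * Real.pi / |w|)
    obtain ⟨b0, b1, b2, b3⟩ := spinVector_solution ha hM hr hC hw h1 h2 hγ hs t
    rw [hcos, hsin] at a0 a1
    have e0 := mul_left_cancel₀ hω.ne' (a0.trans b0.symm)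
    ext i
    fin_cases i
    · exact e0
    · exact mul_left_cancel₀ hκ (a1.trans b1.symm)
    · exact a2.trans b2.symm
    · exact a3.trans (e0 ▸ b3.symm)

lemma uniquePeriodic_of_ne_sq (ha : a ≠ 0) (hM : 0 < M) (hr : r < 0) (hC : 0 < cubic M a r)
    (hw : w ^ 2 * cubic M a r = -r) (h1 : ∀ t, γ t 1 = r)
    (h2 : ∀ t, γ t 2 = Real.pi / 2) (hγ : ∀ t, deriv γ t = Pi.single 3 w)
    (hn : ¬ ∃ n : ℕ, Gam M a r = (n : ℝ) ^ 2) : UniquePeriodic M a γ (2 * Real.pi / |w|) := by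
  have hw0 : w ≠ 0 := by
    rintro rfl
    linarith
  have hr' := hr.ne
  have hω := spinFreq_pos ha hM hr hC hw0
  have hκ := spinCoupling_ne_zero ha hM hr hw0
  have hG := Gam_pos ha hM hr hC
  have hωT : spinFreq M a r w * (2 * Real.pi / |w|) = √(Gam M a r) * (2 * Real.pi) := by
    rw [spinFreq]
    field_simp
  have hcos : Real.cos (spinFreq M a r w * (2 * Real.pi / |w|)) ≠ 1 := by
    rw [hωT]
    intro hcos
    obtain ⟨k, hk⟩ := (Real.cos_eq_one_iff _).1 hcos
    have hk' : (k : ℝ) = √(Gam M a r) := mul_right_cancel₀ Real.two_pi_pos.ne' hk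
    refine hn ⟨k.natAbs, ?_⟩
    rw [Nat.cast_natAbs, Int.cast_abs, sq_abs, hk', Real.sq_sqrt hG.le]
  refine ⟨fun _ => ![0, 0, r⁻¹, 0], ?_⟩
  have hneg : -(fun _ : ℝ => ![0, 0, r⁻¹, 0]) = fun _ : ℝ => ![0, 0, -r⁻¹, 0] := by
    ext t i
    fin_cases i <;> simp
  ext s
  rw [hneg]
  constructor
  · rintro ⟨hs, hper⟩
    have hp := hper 0
    rw [zero_add] at hp
    obtain ⟨a0, a1, -, -⟩ := spinVector_solution ha hM hr hC hw h1 h2 hγ hs (2 * Real.pi / |w|)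
    rw [hp] at a0 a1
    set p := spinFreq M a r w * s 0 0
    set q := spinCoupling M a r w * s 0 1
    set C := Real.cos (spinFreq M a r w * (2 * Real.pi / |w|))
    set S := Real.sin (spinFreq M a r w * (2 * Real.pi / |w|))
    have hpos : 0 < (C - 1) ^ 2 + S ^ 2 := by
      have := sub_ne_zero.2 hcos
      positivity
    -- The second factor is the determinant of the rotation minus the identity; it is nonzero, so
    -- the only fixed vector is zero.
    have hzero : (p ^ 2 + q ^ 2) * ((C - 1) ^ 2 + S ^ 2) = 0 := by
      linear_combination -(p * (C - 1) + q * S) * a0 - (q * (C - 1) - p * S) * a1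
    have hpq := (mul_eq_zero.1 hzero).resolve_right hpos.ne'
    have hp0 : p = 0 := by nlinarith [sq_nonneg p, sq_nonneg q]
    have hq0 : q = 0 := by nlinarith [sq_nonneg p, sq_nonneg q]
    have hst : ∀ t, s t = ![0, 0, s 0 2, 0] := fun t => by
      obtain ⟨b0, b1, b2, b3⟩ := spinVector_solution ha hM hr hC hw h1 h2 hγ hs t
      have e0 : s t 0 = 0 := by
        refine (mul_eq_zero.1 (b0.trans ?_)).resolve_left hω.ne'
        linear_combination Real.cos (spinFreq M a r w * t) * hp0
          + Real.sin (spinFreq M a r w * t) * hq0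
      have e1 : s t 1 = 0 := by
        refine (mul_eq_zero.1 (b1.trans ?_)).resolve_left hκ
        linear_combination Real.cos (spinFreq M a r w * t) * hq0
          - Real.sin (spinFreq M a r w * t) * hp0
      ext i
      fin_cases i
      · exact e0
      · exact e1
      · exact b2
      · simpa [e0] using b3
    have hu := hs.unit 0
    rw [hst 0, scal_equator hr' (h1 0) (h2 0)] at hu
    have hu' : (s 0 2 * r) ^ 2 = 1 := by
      simp at hu
      linear_combination hu
    rcases sq_eq_sq_iff_eq_or_eq_neg.1 (hu'.trans (one_pow 2).symm) with h | h
    · left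
      funext t
      rw [hst t, eq_inv_of_mul_eq_one_left h]
    · right
      funext t
      rw [hst t, show s 0 2 = -r⁻¹ by field_simp; exact h]
  · rintro (rfl | rfl)
    · exact ⟨isSpinVector_normal hM hr hC hw h1 h2 hγ (by field_simp), fun _ => rfl⟩
    · exact ⟨isSpinVector_normal hM hr hC hw h1 h2 hγ (by field_simp), fun _ => rfl⟩

end

end Kerr

/-! ### Periodicity on each circular CTC, and the count of consistent radii -/

namespace Kerr

open Lorentz

section

variable {M a r T : ℝ} {γ : ℝ → Fin 4 → ℝ}

lemma isEquatorialRadius_iff (hM : 0 < M) :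
    IsEquatorialRadius M a r ↔ r < 0 ∧ 0 < cubic M a r :=
  ⟨fun ⟨_, _, h⟩ => h.radius_neg_and_cubic_pos hM, fun h => isEquatorialRadius_of_neg hM h.1 h.2⟩

lemma IsCircularCTC.periodicity (ha : a ≠ 0) (hM : 0 < M)
    (h : IsCircularCTC M a r (Real.pi / 2) γ T) :
    T = 2 * Real.pi * √(-gPhiPhi M a r (Real.pi / 2)) ∧
      (AllPeriodic M a γ T ↔ ∃ n : ℕ, Gam M a r = (n : ℝ) ^ 2) ∧
      ((¬ ∃ n : ℕ, Gam M a r = (n : ℝ) ^ 2) → UniquePeriodic M a γ T) := by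
  obtain ⟨hr, hC⟩ := h.radius_neg_and_cubic_pos hM
  obtain ⟨w, hw, hγ⟩ := h.exists_velocity hM
  have hw0 : w ≠ 0 := by
    rintro rfl
    linarith
  rw [two_pi_mul_sqrt_gPhiPhi hr hw]
  have hT := h.period_eq hw0 hγ
  refine ⟨hT, ?_, ?_⟩ <;> rw [hT]
  · exact allPeriodic_iff ha hM hr hC hw h.r_const h.theta_const hγ
  · exact uniquePeriodic_of_ne_sq ha hM hr hC hw h.r_const h.theta_const hγ

/-- The periodicity clause of the definition follows from the level equation by the criterion. -/
lemma consistentRadii_eq (ha : a ≠ 0) (hM : 0 < M) (n : ℕ) :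
    consistentRadii M a n = {r | IsEquatorialRadius M a r ∧ Gam M a r = (n : ℝ) ^ 2} := by
  ext r
  exact ⟨fun h => ⟨h.1, h.2.1⟩,
    fun h => ⟨h.1, h.2, fun γ T hγ => (hγ.periodicity ha hM).2.1.2 ⟨n, h.2⟩⟩⟩

end

end Kerr

theorem mainTheorem7 (M a : ℝ) (ha : 0 < |a|) (hM : |a| ≤ M) :
    ∃ rs : ℝ,
      -- `rs` is the unique negative root of the cubic
      (rs < 0 ∧ Kerr.cubic M a rs = 0 ∧ ∀ x < 0, Kerr.cubic M a x = 0 → x = rs) ∧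
      -- equatorial circular CTCs occur exactly for radii in `(rs, 0)`
      (∀ r : ℝ, Kerr.IsEquatorialRadius M a r ↔ r ∈ Set.Ioo rs 0) ∧
      -- the periodicity criterion on each of them
      (∀ (r : ℝ) (γ : ℝ → Fin 4 → ℝ) (T : ℝ), Kerr.IsCircularCTC M a r (Real.pi / 2) γ T →
        T = 2 * Real.pi * √(-Kerr.gPhiPhi M a r (Real.pi / 2)) ∧
        (Kerr.AllPeriodic M a γ T ↔ ∃ n : ℕ, Kerr.Gam M a r = (n : ℝ) ^ 2) ∧
        ((¬ ∃ n : ℕ, Kerr.Gam M a r = (n : ℝ) ^ 2) → Kerr.UniquePeriodic M a γ T)) ∧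
      -- behaviour of `Γ` at the endpoints
      Tendsto (Kerr.Gam M a) (𝓝[>] rs) atTop ∧
      Tendsto (Kerr.Gam M a) (𝓝[<] 0) atTop ∧
      -- the unique positive minimum, and the number of consistent radii at each level
      ∃ rm ∈ Set.Ioo rs 0,
        0 < Kerr.Gam M a rm ∧
        (∀ r ∈ Set.Ioo rs 0, r ≠ rm → Kerr.Gam M a rm < Kerr.Gam M a r) ∧
        (∀ r ∈ Set.Ioo rs 0, IsLocalMin (Kerr.Gam M a) r → r = rm) ∧
        (∀ n : ℕ, Kerr.Gam M a rm < (n : ℝ) ^ 2 → (Kerr.consistentRadii M a n).ncard = 2) ∧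
        (∀ n : ℕ, Kerr.Gam M a rm = (n : ℝ) ^ 2 → Kerr.consistentRadii M a n = {rm}) ∧
        (∀ n : ℕ, (n : ℝ) ^ 2 < Kerr.Gam M a rm → Kerr.consistentRadii M a n = ∅) ∧
        ((∀ n : ℕ, Kerr.Gam M a rm ≠ (n : ℝ) ^ 2) →
          Kerr.GodelProfile M a ⌈√(Kerr.Gam M a rm)⌉₊) := by
  have ha0 : a ≠ 0 := abs_pos.1 ha
  have hM0 : 0 < M := ha.trans_le hM
  obtain ⟨rs, hrs, hc⟩ := Kerr.exists_neg_root_cubic ha0 hM0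
  have hmono := Kerr.cubic_strictMono (M := M) ha0
  have hrad : ∀ r : ℝ, Kerr.IsEquatorialRadius M a r ↔ r ∈ Set.Ioo rs 0 := fun r => by
    -- Rewriting with `← hc` replaces every `0`, including the right endpoint of the interval, so
    -- the two sides still match.
    rw [Kerr.isEquatorialRadius_iff hM0, ← hc, hmono.lt_iff_lt, and_comm, Set.mem_Ioo]
  have hlim := Kerr.tendsto_Gam_root ha0 hM0 hrs hc
  have hlim' := Kerr.tendsto_Gam_zero ha0 hM0 hrs hc
  obtain ⟨rm, hrm, hanti, hinc, hloc⟩ := Kerr.exists_Gam_min ha0 hM0 hrs hc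
  have hmin : ∀ r ∈ Set.Ioo rs 0, r ≠ rm → Kerr.Gam M a rm < Kerr.Gam M a r := by
    intro r hr hne
    rcases lt_or_gt_of_ne hne with h | h
    · exact hanti ⟨hr.1, h.le⟩ ⟨hrm.1, le_rfl⟩ h
    · exact hinc ⟨le_rfl, hrm.2⟩ ⟨h.le, hr.2⟩ h
  have hpos : ∀ r ∈ Set.Ioo rs 0, 0 < Kerr.Gam M a r := fun r hr =>
    Kerr.Gam_pos ha0 hM0 hr.2 (Kerr.cubic_pos_of_mem ha0 hc hr.1)
  have hcons : ∀ n : ℕ, Kerr.consistentRadii M a n =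
      {r | r ∈ Set.Ioo rs 0 ∧ Kerr.Gam M a r = (n : ℝ) ^ 2} := fun n => by
    simp only [Kerr.consistentRadii_eq ha0 hM0, hrad]
  have htwo : ∀ n : ℕ, Kerr.Gam M a rm < (n : ℝ) ^ 2 →
      (Kerr.consistentRadii M a n).ncard = 2 := fun n hn => by
    rw [hcons]
    exact Kerr.ncard_level_eq_two hrm (fun r hr => (Kerr.hasDerivAt_Gam hr.2.ne
      (Kerr.cubic_pos_of_mem ha0 hc hr.1).ne').continuousAt.continuousWithinAt)
      hanti hinc hlim hlim' hn
  have hge : ∀ r ∈ Set.Ioo rs 0, Kerr.Gam M a rm ≤ Kerr.Gam M a r := fun r hr => by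
    rcases eq_or_ne r rm with rfl | hne
    · exact le_rfl
    · exact (hmin r hr hne).le
  refine ⟨rs, ⟨hrs, hc, fun x _ hx => hmono.injective (hx.trans hc.symm)⟩, hrad,
    fun r γ T h => h.periodicity ha0 hM0, hlim, hlim', rm, hrm, hpos rm hrm, hmin, hloc, htwo,
    fun n hn => ?_, fun n hn => ?_, fun hne => ⟨fun n hn => ⟨htwo n ?_, ?_⟩, ?_⟩⟩
  · rw [hcons]
    ext r
    constructor
    · rintro ⟨hr, h⟩
      by_contra hr'
      exact (hmin r hr hr').ne (hn.trans h.symm)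
    · rintro rfl
      exact ⟨hrm, hn⟩
  · rw [hcons, Set.eq_empty_iff_forall_notMem]
    rintro r ⟨hr, h⟩
    exact (hge r hr).not_gt (h ▸ hn)
  · exact lt_of_le_of_ne ((Real.sqrt_le_left n.cast_nonneg).1 (Nat.ceil_le.1 hn)) (hne n)
  · exact Kerr.consistentRadii_eq ha0 hM0 n
  · intro r γ T h hr
    refine (h.periodicity ha0 hM0).2.2 ?_
    rintro ⟨n, hn⟩
    have hr' := (hrad r).1 ⟨γ, T, h⟩
    -- Any level that is attained is at least the minimum of `Γ`, so `n` automatically lies above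
    -- the threshold.
    refine hr n (Nat.ceil_le.2 ((Real.sqrt_le_left n.cast_nonneg).2 (hn ▸ hge r hr'))) ?_
    rw [hcons]
    exact ⟨hr', hn⟩
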